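/- Let $Y$ be a Young diagram, that is, a left-aligned array of finitely many rows of cells whose row lengths $l_1\le l_2\le\dots\le l_m$ (from bottom to top) are nonnegative integers. Say that $Y$ is \emph{Latin} if its cells can be filled with integers so that each row of length $\ell$ is populated by the numbers $1,\dots,\ell$ and the numbers in each column are distinct. Let $a_1<a_2<\dots<a_p$ be the distinct row lengths of $Y$, and for $1\le i\le p$ let $e_i\ge 1$ be the number of rows of length $a_i$. Put $a_0=0$ and $b_i=a_i-a_{i-1}$ for $1\le i\le p$. An \emph{allocation} for $Y$ is a collection of nonnegative integers $z_{ijk}$, for $1\le j,k\le i\le p$, satisfying \begin{align*} &\sum_{k=1}^{i} z_{ijk}=e_ib_j &&\text{for } 1\le j\le i\le p,\\ &\sum_{j=1}^{i} z_{ijk}=e_ib_k &&\text{for } 1\le k\le i\le p,\\ &\sum_{i=\max(j,k)}^{p} z_{ijk}\le b_jb_k &&\text{for } 1\le j,k\le p. \end{align*} Theorem. A Young diagram $Y$ has an allocation if and only if $Y$ is Latin. -/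

import Mathlib

/-- A Latin filling of a Young diagram: the cell in row `r` and column `c` (both counted from `0`)
receives the number `f r c`; a row of length `ℓ` is populated by the numbers `1, …, ℓ`, and the
numbers in each column are distinct. Values of `f` outside the diagram are irrelevant. -/
structure IsLatinFilling (Y : YoungDiagram) (f : ℕ → ℕ → ℕ) : Prop where
  row : ∀ r, Set.BijOn (f r) {c | (r, c) ∈ Y} (Set.Icc 1 (Y.rowLen r))
  col : ∀ c, Set.InjOn (fun r => f r c) {r | (r, c) ∈ Y}

/-- A Young diagram is Latin if it has a Latin filling. -/
def IsLatin (Y : YoungDiagram) : Prop :=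
  ∃ f : ℕ → ℕ → ℕ, IsLatinFilling Y f

/-- The number `p` of distinct entries of a list `w` of row lengths. -/
def numBlocks (w : List ℕ) : ℕ :=
  w.toFinset.card

/-- The distinct entries `a 1 < a 2 < ⋯ < a p` of a list `w` of row lengths, preceded by
`a 0 = 0`. (The value is `0` for indices above `p`.) -/
def blockLen (w : List ℕ) (i : ℕ) : ℕ :=
  (0 :: w.toFinset.sort (· ≤ ·)).getD i 0

/-- The number `e i` of rows of length `a i`, for `1 ≤ i ≤ p`. -/
def blockHeight (w : List ℕ) (i : ℕ) : ℕ :=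
  w.count (blockLen w i)

/-- The width `b i = a i - a (i - 1)` of the `i`-th column block, for `1 ≤ i ≤ p`. -/
def blockWidth (w : List ℕ) (i : ℕ) : ℕ :=
  blockLen w i - blockLen w (i - 1)

/-- An allocation for the Young diagram with row lengths `w`. Only the values `z i j k` with
`1 ≤ j, k ≤ i ≤ p` matter. -/
structure IsAllocation (w : List ℕ) (z : ℕ → ℕ → ℕ → ℕ) : Prop where
  sum_symbols : ∀ i j, 1 ≤ j → j ≤ i → i ≤ numBlocks w →
    ∑ k ∈ Finset.Icc 1 i, z i j k = blockHeight w i * blockWidth w j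
  sum_columns : ∀ i k, 1 ≤ k → k ≤ i → i ≤ numBlocks w →
    ∑ j ∈ Finset.Icc 1 i, z i j k = blockHeight w i * blockWidth w k
  sum_rows : ∀ j k, 1 ≤ j → j ≤ numBlocks w → 1 ≤ k → k ≤ numBlocks w →
    ∑ i ∈ Finset.Icc (max j k) (numBlocks w), z i j k ≤ blockWidth w j * blockWidth w k

/-- The Young diagram with row lengths `w` has an allocation. -/
def HasAllocation (w : List ℕ) : Prop :=
  ∃ z : ℕ → ℕ → ℕ → ℕ, IsAllocation w z

open Finset

/-! An allocation is what remains of a Latin filling when rows are merged by length, and columns and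
symbols are merged into intervals of widths `b i`. Cell presence depends only on the blocks, so
counting over blocks turns a filling into an allocation. For the converse, the merging is undone one
coordinate at a time: rows, then columns, then symbols. Each time the remaining two coordinates form
a nonnegative integer matrix whose line sums are at most the number of new parts times a capacity.
Such a matrix splits into parts whose line sums respect the capacities
(`exists_balanced_decomposition`), and lines meeting the bound split evenly. This is balanced edge
colouring of a bipartite multigraph: split vertices to reduce to capacity 1, pad to a regular
matrix, and extract perfect matchings by Hall's theorem. -/

/-! ### Balanced decompositions of nonnegative integer matrices -/

/-- A function with sum at most `n * u` is a sum of `u` functions with sums at most `n`. -/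
theorem exists_split_function {Y : Type*} [Fintype Y] (n : ℕ) (u : ℕ) (f : Y → ℕ)
    (hf : ∑ y, f y ≤ n * u) :
    ∃ g : Fin u → Y → ℕ, (∀ y, ∑ i, g i y = f y) ∧ ∀ i, ∑ y, g i y ≤ n := by
  classical
  induction u generalizing f with
  | zero =>
    refine ⟨fun _ _ => 0, fun y => ?_, fun i => i.elim0⟩
    have h : ∑ y, f y = 0 := by simpa using hf
    simpa using ((Finset.sum_eq_zero_iff.1 h) y (mem_univ y)).symm
  | succ u ih =>
    obtain ⟨g, hgf, hg, hfg⟩ : ∃ g : Y → ℕ, (∀ y, g y ≤ f y) ∧ ∑ y, g y ≤ n ∧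
        ∑ y, (f y - g y) ≤ n * u := by
      -- Greedy choice: add units to `g` until its sum is `m` or `g = f`. The subtraction of `m`
      -- truncates, which covers the second case.
      have key : ∀ m, ∃ g : Y → ℕ, (∀ y, g y ≤ f y) ∧ ∑ y, g y ≤ m ∧
          ∑ y, (f y - g y) ≤ (∑ y, f y) - m := by
        intro m
        induction m with
        | zero => exact ⟨fun _ => 0, by simp, by simp, by simp⟩
        | succ m ihm =>
          obtain ⟨g, h1, h2, h3⟩ := ihm
          by_cases h : ∀ y, f y = g y
          · exact ⟨g, h1, by omega, by simp [h]⟩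
          · push Not at h
            obtain ⟨y, hy⟩ := h
            have hlt : g y < f y := lt_of_le_of_ne (h1 y) (Ne.symm hy)
            have hs : ∑ x, (g x + if x = y then 1 else 0) = ∑ x, g x + 1 := by
              simp [Finset.sum_add_distrib]
            have hle : ∀ x, (g x + if x = y then 1 else 0) ≤ f x := by
              intro x
              split_ifs with hx
              · subst hx; omega
              · simpa using h1 x
            refine ⟨fun x => g x + if x = y then 1 else 0, hle, hs.trans_le (by omega), ?_⟩
            have e1 := Finset.sum_tsub_distrib (univ : Finset Y) (fun x _ => h1 x)
            have e2 := Finset.sum_tsub_distrib (univ : Finset Y) (fun x _ => hle x)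
            rw [e2, hs]
            omega
      obtain ⟨g, h1, h2, h3⟩ := key n
      refine ⟨g, h1, h2, h3.trans ?_⟩
      rw [Nat.mul_succ] at hf
      omega
    obtain ⟨G, hG, hG'⟩ := ih (fun y => f y - g y) hfg
    refine ⟨Fin.cons g G, fun y => ?_, fun i => ?_⟩
    · rw [Fin.sum_univ_succ]
      simp only [Fin.cons_zero, Fin.cons_succ, hG]
      have := hgf y
      omega
    · refine Fin.cases ?_ (fun i => ?_) i
      · simpa using hg
      · simpa using hG' i

/-- A row of a nonnegative integer matrix with sum at most `n * u` splits into `u` rows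
with sums at most `n`. -/
theorem exists_split_rows {X Y : Type*} [Fintype Y] (n : ℕ) (u : X → ℕ)
    (M : X → Y → ℕ) (hM : ∀ x, ∑ y, M x y ≤ n * u x) :
    ∃ N : (Σ x, Fin (u x)) → Y → ℕ,
      (∀ x y, ∑ i, N ⟨x, i⟩ y = M x y) ∧ ∀ q, ∑ y, N q y ≤ n := by
  choose g h1 h2 using fun x => exists_split_function n (u x) (M x) (hM x)
  exact ⟨fun q => g q.1 q.2, h1, fun q => h2 q.1 q.2⟩

/-- A nonnegative integer matrix with all line sums equal to `n` is a sum of `n` permutation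
matrices. -/
theorem exists_bijections_of_regular {X Y : Type*} [Fintype X] [Fintype Y] [DecidableEq Y]
    (n : ℕ) (N : X → Y → ℕ) (hr : ∀ x, ∑ y, N x y = n) (hc : ∀ y, ∑ x, N x y = n) :
    ∃ σ : Fin n → X → Y, (∀ t, Function.Bijective (σ t)) ∧
      ∀ x y, ∑ t, (if σ t x = y then 1 else 0) = N x y := by
  classical
  induction n generalizing N with
  | zero =>
    refine ⟨fun t => t.elim0, fun t => t.elim0, fun x y => ?_⟩
    simpa using ((Finset.sum_eq_zero_iff.1 (hr x)) y (mem_univ y)).symm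
  | succ n ih =>
    -- Hall's condition by double counting: the rows in `s` carry total weight `#s * (n + 1)`, all
    -- within the columns `T`, each of which carries `n + 1`.
    have hall : ∀ s : Finset X, #s ≤ #(s.biUnion fun x => univ.filter fun y => 0 < N x y) := by
      intro s
      set T := s.biUnion fun x => univ.filter fun y => 0 < N x y with hT
      have h1 : ∑ x ∈ s, ∑ y ∈ T, N x y = #s * (n + 1) := by
        rw [Finset.sum_const_nat]
        intro x hx
        rw [← hr x]
        refine Finset.sum_subset (subset_univ _) fun y _ hy => ?_
        by_contra h
        exact hy (mem_biUnion.2 ⟨x, hx, by simpa using Nat.pos_of_ne_zero h⟩)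
      have h2 : ∑ x ∈ s, ∑ y ∈ T, N x y ≤ #T * (n + 1) := by
        rw [Finset.sum_comm]
        refine Finset.sum_le_card_nsmul _ _ _ fun y _ => ?_
        rw [← hc y]
        exact Finset.sum_le_sum_of_subset (subset_univ _)
      exact Nat.le_of_mul_le_mul_right (h1 ▸ h2) n.succ_pos
    obtain ⟨f, hinj, hf⟩ := (Finset.all_card_le_biUnion_card_iff_exists_injective _).1 hall
    have hcard : Fintype.card X = Fintype.card Y := by
      have h : ∑ x, ∑ y, N x y = ∑ y, ∑ x, N x y := Finset.sum_comm
      simp only [hr, hc, sum_const, card_univ, smul_eq_mul] at h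
      exact Nat.eq_of_mul_eq_mul_right n.succ_pos h
    have hbij : Function.Bijective f :=
      (Fintype.bijective_iff_injective_and_card f).2 ⟨hinj, hcard⟩
    have hle : ∀ x y, (if f x = y then 1 else 0) ≤ N x y := by
      intro x y
      split_ifs with h
      · subst h
        exact (mem_filter.1 (hf x)).2
      · exact Nat.zero_le _
    obtain ⟨σ, hσ, hσN⟩ := ih (fun x y => N x y - if f x = y then 1 else 0)
      (fun x => by
        rw [Finset.sum_tsub_distrib _ (fun y _ => hle x y), hr]
        simp)
      (fun y => by
        rw [Finset.sum_tsub_distrib _ (fun x _ => hle x y), hc]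
        obtain ⟨x, rfl⟩ := hbij.2 y
        simp [hinj.eq_iff])
    refine ⟨Fin.cons f σ, fun t => ?_, fun x y => ?_⟩
    · refine Fin.cases ?_ (fun t => ?_) t
      · simpa using hbij
      · simpa using hσ t
    · rw [Fin.sum_univ_succ]
      simp only [Fin.cons_zero, Fin.cons_succ, hσN]
      have := hle x y
      omega

/-- A nonnegative integer matrix with all line sums at most `n` is a sum of `n` matrices with
all line sums at most `1`. -/
theorem exists_decomposition_of_le {A B : Type*} [Fintype A] [Fintype B]
    (n : ℕ) (M : A → B → ℕ) (hr : ∀ a, ∑ b, M a b ≤ n) (hc : ∀ b, ∑ a, M a b ≤ n) :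
    ∃ D : Fin n → A → B → ℕ, (∀ a b, ∑ t, D t a b = M a b) ∧
      (∀ t a, ∑ b, D t a b ≤ 1) ∧ ∀ t b, ∑ a, D t a b ≤ 1 := by
  classical
  -- Pad `M` to the block matrix with `M` and its transpose on the diagonal and diagonal matrices of
  -- row and column deficits off it; every line sum is then `n`.
  let N : A ⊕ B → B ⊕ A → ℕ := Sum.elim
    (fun a => Sum.elim (fun b => M a b) (fun a' => if a = a' then n - ∑ b, M a b else 0))
    (fun b => Sum.elim (fun b' => if b = b' then n - ∑ a, M a b else 0) (fun a => M a b))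
  obtain ⟨σ, hσ, hN⟩ := exists_bijections_of_regular n N
    (by
      rintro (a | b)
      · have := hr a
        simp [N]; omega
      · have := hc b
        simp [N]; omega)
    (by
      rintro (b | a)
      · have := hc b
        simp [N]; omega
      · have := hr a
        simp [N]; omega)
  refine ⟨fun t a b => if σ t (Sum.inl a) = Sum.inl b then 1 else 0,
    fun a b => hN (Sum.inl a) (Sum.inl b), fun t a => ?_, fun t b => ?_⟩
  · rw [Finset.sum_boole, Nat.cast_id, Finset.card_le_one]
    intro b hb b' hb'
    simp only [mem_filter, mem_univ, true_and] at hb hb'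
    exact Sum.inl_injective (hb.symm.trans hb')
  · rw [Finset.sum_boole, Nat.cast_id, Finset.card_le_one]
    intro a ha a' ha'
    simp only [mem_filter, mem_univ, true_and] at ha ha'
    exact Sum.inl_injective ((hσ t).1 (ha.trans ha'.symm))

/-- A nonnegative integer matrix whose line sums are at most `n` times given capacities is a sum of
`n` matrices whose line sums respect the capacities. -/
theorem exists_balanced_decomposition {A B T : Type*} [Fintype A] [Fintype B] [Fintype T]
    (M : A → B → ℕ) (u : A → ℕ) (v : B → ℕ)
    (hr : ∀ a, ∑ b, M a b ≤ Fintype.card T * u a) (hc : ∀ b, ∑ a, M a b ≤ Fintype.card T * v b) :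
    ∃ D : T → A → B → ℕ, (∀ a b, ∑ t, D t a b = M a b) ∧
      (∀ t a, ∑ b, D t a b ≤ u a) ∧ ∀ t b, ∑ a, D t a b ≤ v b := by
  -- Vertex splitting: line `a` becomes `u a` lines and line `b` becomes `v b` lines, all of sum at
  -- most `card T`. Merging them back turns the bounds `1` into `u a` and `v b`.
  obtain ⟨M₁, hM₁, hM₁r⟩ := exists_split_rows _ u M hr
  have hc₁ : ∀ b, ∑ q, M₁ q b ≤ Fintype.card T * v b := by
    intro b
    rw [Fintype.sum_sigma]
    simpa only [hM₁] using hc b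
  obtain ⟨M₂, hM₂, hM₂r⟩ := exists_split_rows _ v (fun b q => M₁ q b) hc₁
  obtain ⟨D, hD, hDr, hDc⟩ := exists_decomposition_of_le (Fintype.card T) (fun q q' => M₂ q' q)
    (by
      intro q
      rw [Fintype.sum_sigma]
      simpa only [hM₂] using hM₁r q)
    hM₂r
  let e := Fintype.equivFin T
  refine ⟨fun t a b => ∑ i, ∑ j, D (e t) ⟨a, i⟩ ⟨b, j⟩, fun a b => ?_, fun t a => ?_, fun t b => ?_⟩
  · rw [e.sum_comp fun t => ∑ i, ∑ j, D t ⟨a, i⟩ ⟨b, j⟩, Finset.sum_comm]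
    simp_rw [← hM₁ a b]
    refine Finset.sum_congr rfl fun i _ => ?_
    rw [Finset.sum_comm, ← hM₂]
    exact Finset.sum_congr rfl fun j _ => hD _ _
  · rw [Finset.sum_comm]
    calc ∑ i, ∑ b, ∑ j, D (e t) ⟨a, i⟩ ⟨b, j⟩ = ∑ i, ∑ q, D (e t) ⟨a, i⟩ q := by
          simp_rw [Fintype.sum_sigma]
      _ ≤ ∑ i : Fin (u a), 1 := Finset.sum_le_sum fun i _ => hDr _ _
      _ = u a := by simp
  · calc ∑ a, ∑ i, ∑ j, D (e t) ⟨a, i⟩ ⟨b, j⟩ = ∑ q, ∑ j, D (e t) q ⟨b, j⟩ := by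
          rw [Fintype.sum_sigma]
      _ = ∑ j, ∑ q, D (e t) q ⟨b, j⟩ := Finset.sum_comm
      _ ≤ ∑ j : Fin (v b), 1 := Finset.sum_le_sum fun i _ => hDc _ _
      _ = v b := by simp

/-- If `card T` numbers are at most `u` and sum to `card T * u`, they all equal `u`. -/
theorem eq_of_sum_eq_card_mul {T : Type*} [Fintype T] {g : T → ℕ} {u : ℕ} (hg : ∀ t, g t ≤ u)
    (h : ∑ t, g t = Fintype.card T * u) (t : T) : g t = u :=
  (Finset.sum_eq_sum_iff_of_le fun t _ => hg t).1 (by simpa using h) t (mem_univ t)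

/-- In `exists_balanced_decomposition`, lines of `M` with extremal sum are split evenly; here this
is the case for all rows. -/
theorem exists_balanced_decomposition_of_eq {A B T : Type*} [Fintype A] [Fintype B] [Fintype T]
    (M : A → B → ℕ) (u : A → ℕ) (v : B → ℕ)
    (hr : ∀ a, ∑ b, M a b = Fintype.card T * u a) (hc : ∀ b, ∑ a, M a b ≤ Fintype.card T * v b) :
    ∃ D : T → A → B → ℕ, (∀ a b, ∑ t, D t a b = M a b) ∧
      (∀ t a, ∑ b, D t a b = u a) ∧ ∀ t b, ∑ a, D t a b ≤ v b := by
  obtain ⟨D, hD, hDr, hDc⟩ := exists_balanced_decomposition M u v (fun a => (hr a).le) hc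
  refine ⟨D, hD, fun t a => ?_, hDc⟩
  refine eq_of_sum_eq_card_mul (g := fun t => ∑ b, D t a b) (fun t => hDr t a) ?_ t
  rw [Finset.sum_comm, ← hr a]
  exact Finset.sum_congr rfl fun b _ => hD a b

/-! ### Outline arrays and their disentangling -/

/-- `z i j k` counts the symbols of block `k` in the cells of row block `i` and column block `j` of an
amalgamated Latin array. Row blocks have sizes `e`, column and symbol blocks have sizes `b`, and
`d i j` is `1` or `0` according to whether the cells of row block `i` and column block `j`
are present. -/
structure IsOutline {I : Type*} [Fintype I] (e b : I → ℕ) (d : I → I → ℕ)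
    (z : I → I → I → ℕ) : Prop where
  sum_symbols : ∀ i j, ∑ k, z i j k = e i * (b j * d i j)
  sum_columns : ∀ i k, ∑ j, z i j k = e i * (b k * d i k)
  sum_rows : ∀ j k, ∑ i, z i j k ≤ b j * b k

/-- The incidence array of a partial Latin array: in row `r`, the columns and the symbols `c` with
`D r c = 1` are matched bijectively, and no symbol occurs twice in a column. -/
structure IsIncidenceArray {R C : Type*} [Fintype R] [Fintype C] (D : R → C → ℕ)
    (x : R → C → C → ℕ) : Prop where
  sum_symbols : ∀ r c, ∑ s, x r c s = D r c
  sum_columns : ∀ r s, ∑ c, x r c s = D r s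
  sum_rows : ∀ c s, ∑ r, x r c s ≤ 1

section Outline

variable {I R C : Type*} [Fintype I] [DecidableEq I] [Fintype R] [Fintype C]
  {ρ : R → I} {κ : C → I} {d : I → I → ℕ}

/-- Every outline array is the amalgamation of an incidence array. -/
theorem IsOutline.exists_isIncidenceArray {z : I → I → I → ℕ}
    (hz : IsOutline (fun i => Fintype.card {r // ρ r = i}) (fun j => Fintype.card {c // κ c = j})
      d z) :
    ∃ x, IsIncidenceArray (fun r c => d (ρ r) (κ c)) x := by
  -- Separate the rows of block `i`. Both margins of `z i` are extremal, so every row receives its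
  -- exact share of each column block and of each symbol block.
  choose Y hYz hYj hYk using fun i => exists_balanced_decomposition_of_eq (T := {r // ρ r = i})
    (z i) (fun j => Fintype.card {c // κ c = j} * d i j)
    (fun k => Fintype.card {c // κ c = k} * d i k)
    (hz.sum_symbols i) (fun k => (hz.sum_columns i k).le)
  have hYk' : ∀ i t k, ∑ j, Y i t j k = Fintype.card {c // κ c = k} * d i k := by
    intro i t k
    refine eq_of_sum_eq_card_mul (g := fun t => ∑ j, Y i t j k) (fun t => hYk i t k) ?_ t
    rw [Finset.sum_comm]
    simp_rw [hYz]
    exact hz.sum_columns i k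
  have hsumY : ∀ j k, ∑ r, Y (ρ r) ⟨r, rfl⟩ j k = ∑ i, z i j k := by
    intro j k
    rw [← Fintype.sum_fiberwise ρ]
    refine Finset.sum_congr rfl fun i _ => ?_
    rw [← hYz i j k]
    refine Finset.sum_congr rfl fun t _ => ?_
    obtain ⟨r, rfl⟩ := t
    rfl
  -- Separate the columns of block `j`. Each cell gets exactly `d` symbols; the bound `b j * b k`
  -- leaves each column at most `b k` symbols of block `k`.
  choose X hXY hXr hXk using fun j => exists_balanced_decomposition_of_eq (T := {c // κ c = j})
    (fun r k => Y (ρ r) ⟨r, rfl⟩ j k) (fun r => d (ρ r) j) (fun k => Fintype.card {c // κ c = k})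
    (fun r => hYj _ _ j) (fun k => (hsumY j k).trans_le (hz.sum_rows j k))
  have hsumX : ∀ r k, ∑ c, X (κ c) ⟨c, rfl⟩ r k = Fintype.card {c // κ c = k} * d (ρ r) k := by
    intro r k
    rw [← Fintype.sum_fiberwise κ, ← hYk' (ρ r) ⟨r, rfl⟩ k]
    refine Finset.sum_congr rfl fun j _ => ?_
    rw [← hXY j r k]
    refine Finset.sum_congr rfl fun t _ => ?_
    obtain ⟨c, rfl⟩ := t
    rfl
  -- Separate the symbols of block `k`. Capacity 1 on columns is the Latin condition.
  choose W hWX hWr hWc using fun k => exists_balanced_decomposition_of_eq (T := {s // κ s = k})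
    (fun r c => X (κ c) ⟨c, rfl⟩ r k) (fun r => d (ρ r) k) (fun _ => 1)
    (fun r => hsumX r k) (fun c => (hXk _ _ k).trans_eq (mul_one _).symm)
  refine ⟨fun r c s => W (κ s) ⟨s, rfl⟩ r c, fun r c => ?_, fun r s => hWr _ _ r,
    fun c s => hWc _ _ c⟩
  rw [← Fintype.sum_fiberwise κ, ← hXr (κ c) ⟨c, rfl⟩ r]
  refine Finset.sum_congr rfl fun k _ => ?_
  rw [← hWX k r c]
  refine Finset.sum_congr rfl fun t _ => ?_
  obtain ⟨s, rfl⟩ := t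
  rfl

/-- The amalgamation of an incidence array is an outline array. -/
theorem IsIncidenceArray.exists_isOutline {x : R → C → C → ℕ}
    (hx : IsIncidenceArray (fun r c => d (ρ r) (κ c)) x) :
    ∃ z, IsOutline (fun i => Fintype.card {r // ρ r = i}) (fun j => Fintype.card {c // κ c = j})
      d z := by
  refine ⟨fun i j k => ∑ r : {r // ρ r = i}, ∑ c : {c // κ c = j}, ∑ s : {s // κ s = k}, x r c s,
    fun i j => ?_, fun i k => ?_, fun j k => ?_⟩
  · rw [Finset.sum_comm]
    rw [← smul_eq_mul, ← card_univ]
    refine Finset.sum_eq_card_nsmul fun r _ => ?_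
    rw [Finset.sum_comm, ← smul_eq_mul, ← card_univ]
    refine Finset.sum_eq_card_nsmul fun c _ => ?_
    rw [Fintype.sum_fiberwise κ, hx.sum_symbols, r.2, c.2]
  · rw [Finset.sum_comm]
    rw [← smul_eq_mul, ← card_univ]
    refine Finset.sum_eq_card_nsmul fun r _ => ?_
    rw [Fintype.sum_fiberwise κ (fun c => ∑ s : {s // κ s = k}, x r c s), Finset.sum_comm,
      ← smul_eq_mul, ← card_univ]
    refine Finset.sum_eq_card_nsmul fun s _ => ?_
    rw [hx.sum_columns, r.2, s.2]
  · rw [Fintype.sum_fiberwise ρ (fun r => ∑ c : {c // κ c = j}, ∑ s : {s // κ s = k}, x r c s),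
      Finset.sum_comm, ← smul_eq_mul, ← card_univ]
    refine Finset.sum_le_card_nsmul _ _ _ fun c _ => ?_
    rw [Finset.sum_comm]
    refine (Finset.sum_le_card_nsmul _ _ 1
      fun (s : {s // κ s = k}) _ => hx.sum_rows c s.1).trans ?_
    simp

end Outline

/-! ### Blocks of rows and columns -/

section Blocks

variable (w : List ℕ)

theorem blockLen_zero : blockLen w 0 = 0 := rfl

theorem blockLen_succ {i : ℕ} (hi : i < numBlocks w) :
    blockLen w (i + 1) = (w.toFinset.sort (· ≤ ·))[i]'(by simpa [numBlocks] using hi) := by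
  have : i < (w.toFinset.sort (· ≤ ·)).length := by simpa [numBlocks] using hi
  simp [blockLen, List.getElem?_eq_getElem this]

/-- Index 0 is excluded because rows of length 0 are allowed, so that `blockLen w 1` may also be 0.
-/
theorem blockLen_lt {i j : ℕ} (hi : 1 ≤ i) (hij : i < j) (hj : j ≤ numBlocks w) :
    blockLen w i < blockLen w j := by
  obtain ⟨i, rfl⟩ := Nat.exists_eq_add_of_le' hi
  obtain ⟨j, rfl⟩ := Nat.exists_eq_add_of_le' (hi.trans hij.le)
  rw [blockLen_succ w (by omega), blockLen_succ w (by omega)]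
  exact (w.toFinset.sortedLT_sort).getElem_lt_getElem_of_lt (by omega)

theorem blockLen_le {i j : ℕ} (hij : i ≤ j) (hj : j ≤ numBlocks w) :
    blockLen w i ≤ blockLen w j := by
  rcases Nat.eq_zero_or_pos i with rfl | hi
  · simp [blockLen_zero]
  · rcases hij.eq_or_lt with rfl | h
    · rfl
    · exact (blockLen_lt w hi h hj).le

theorem exists_blockLen_eq {l : ℕ} (hl : l ∈ w) :
    ∃ i : Icc 1 (numBlocks w), blockLen w i = l := by
  have h : l ∈ w.toFinset.sort (· ≤ ·) := by simpa using hl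
  obtain ⟨i, hi, rfl⟩ := List.getElem_of_mem h
  have hi' : i < numBlocks w := by simpa [numBlocks] using hi
  exact ⟨⟨i + 1, by simp; omega⟩, blockLen_succ w hi'⟩

theorem exists_lt_blockLen {c : ℕ} (hc : c < blockLen w (numBlocks w)) :
    ∃ i : Icc 1 (numBlocks w), blockLen w (i - 1) ≤ c ∧ c < blockLen w i := by
  classical
  have hex : ∃ i, c < blockLen w i := ⟨_, hc⟩
  have h0 : Nat.find hex ≠ 0 := by
    intro h
    have := Nat.find_spec hex
    rw [h, blockLen_zero] at this
    omega
  refine ⟨⟨Nat.find hex, ?_⟩, ?_, Nat.find_spec hex⟩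
  · rw [Finset.mem_Icc]
    exact ⟨Nat.one_le_iff_ne_zero.2 h0, Nat.find_min' hex hc⟩
  · exact not_lt.1 (Nat.find_min hex (Nat.sub_lt (Nat.pos_of_ne_zero h0) one_pos))

/-- The index of the block of a row. -/
noncomputable def rowBlock (r : Fin w.length) : Icc 1 (numBlocks w) :=
  (exists_blockLen_eq w (w.getElem_mem r.2)).choose

theorem blockLen_rowBlock (r : Fin w.length) : blockLen w (rowBlock w r) = w[r] :=
  (exists_blockLen_eq w (w.getElem_mem r.2)).choose_spec

/-- The index of the block of a column. -/
noncomputable def colBlock (c : Fin (blockLen w (numBlocks w))) : Icc 1 (numBlocks w) :=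
  (exists_lt_blockLen w c.2).choose

theorem blockLen_pred_colBlock_le (c : Fin (blockLen w (numBlocks w))) :
    blockLen w (colBlock w c - 1) ≤ c :=
  (exists_lt_blockLen w c.2).choose_spec.1

theorem lt_blockLen_colBlock (c : Fin (blockLen w (numBlocks w))) :
    c < blockLen w (colBlock w c) :=
  (exists_lt_blockLen w c.2).choose_spec.2

theorem colBlock_le_iff (c : Fin (blockLen w (numBlocks w))) (i : Icc 1 (numBlocks w)) :
    colBlock w c ≤ i ↔ c < blockLen w i := by
  have hi := Finset.mem_Icc.1 i.2
  have hk := Finset.mem_Icc.1 (colBlock w c).2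
  constructor
  · intro h
    exact (lt_blockLen_colBlock w c).trans_le (blockLen_le w h hi.2)
  · intro h
    by_contra hlt
    have hlt' : (i : ℕ) < colBlock w c := not_le.1 hlt
    have h1 := blockLen_le w (show (i : ℕ) ≤ (colBlock w c : ℕ) - 1 by omega) (by omega)
    have h2 := blockLen_pred_colBlock_le w c
    omega

theorem colBlock_eq_iff (c : Fin (blockLen w (numBlocks w))) (i : Icc 1 (numBlocks w)) :
    colBlock w c = i ↔ blockLen w (i - 1) ≤ c ∧ c < blockLen w i := by
  refine ⟨?_, fun ⟨h1, h2⟩ => le_antisymm ((colBlock_le_iff w c i).2 h2) ?_⟩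
  · rintro rfl
    exact ⟨blockLen_pred_colBlock_le w c, lt_blockLen_colBlock w c⟩
  · have hi := Finset.mem_Icc.1 i.2
    have hk := Finset.mem_Icc.1 (colBlock w c).2
    by_contra hlt
    have hlt' : (colBlock w c : ℕ) < i := not_le.1 hlt
    have h3 := blockLen_le w (show (colBlock w c : ℕ) ≤ (i : ℕ) - 1 by omega) (by omega)
    have h4 := lt_blockLen_colBlock w c
    omega

theorem rowBlock_eq_iff (r : Fin w.length) (i : Icc 1 (numBlocks w)) :
    rowBlock w r = i ↔ w[r] = blockLen w i := by
  rw [← blockLen_rowBlock]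
  refine ⟨fun h => by rw [h], fun h => ?_⟩
  have hi := Finset.mem_Icc.1 i.2
  have hk := Finset.mem_Icc.1 (rowBlock w r).2
  rcases lt_trichotomy (rowBlock w r : ℕ) i with hlt | heq | hlt
  · exact absurd h (blockLen_lt w hk.1 hlt hi.2).ne
  · exact Subtype.ext heq
  · exact absurd h (blockLen_lt w hi.1 hlt hk.2).ne'

/-- The diagram is a union of whole blocks. The same criterion says which symbols occur in row `r`,
so columns and symbols share one block map. -/
theorem lt_getElem_iff (r : Fin w.length) (c : Fin (blockLen w (numBlocks w))) :
    (c : ℕ) < w[r] ↔ colBlock w c ≤ rowBlock w r := by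
  rw [colBlock_le_iff, blockLen_rowBlock]

theorem getElem_le_blockLen (r : Fin w.length) : w[r] ≤ blockLen w (numBlocks w) := by
  rw [← blockLen_rowBlock]
  exact blockLen_le w (Finset.mem_Icc.1 (rowBlock w r).2).2 le_rfl

theorem card_rowBlock_fiber (i : Icc 1 (numBlocks w)) :
    Fintype.card {r // rowBlock w r = i} = blockHeight w i := by
  classical
  simp_rw [rowBlock_eq_iff]
  rw [blockHeight, Fintype.card_subtype]
  generalize blockLen w i = l
  conv_rhs => rw [← List.ofFn_getElem (xs := w)]
  rw [← Multiset.coe_count, ← Fin.univ_val_map, Multiset.count_map, Finset.card]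
  simp [eq_comm]

theorem card_colBlock_fiber (i : Icc 1 (numBlocks w)) :
    Fintype.card {c // colBlock w c = i} = blockWidth w i := by
  classical
  have hi := Finset.mem_Icc.1 i.2
  rw [blockWidth, ← Nat.card_Ico, Fintype.card_subtype, ← Finset.card_map Fin.valEmbedding]
  congr 1
  ext c
  simp only [mem_map, mem_filter, mem_univ, true_and, colBlock_eq_iff, Fin.valEmbedding_apply,
    Finset.mem_Ico]
  constructor
  · rintro ⟨c, h, rfl⟩
    exact h
  · intro h
    exact ⟨⟨c, h.2.trans_le (blockLen_le w hi.2 le_rfl)⟩, h, rfl⟩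

/-- The indicator of the block positions contained in the diagram. -/
def blockIndicator (i j : Icc 1 (numBlocks w)) : ℕ := if j ≤ i then 1 else 0

/-- Extending an allocation by zero gives an outline array; conversely, an outline array vanishes
unless `j, k ≤ i`, since the other margins are zero. -/
theorem hasAllocation_iff_exists_isOutline :
    HasAllocation w ↔ ∃ z, IsOutline (fun i => Fintype.card {r // rowBlock w r = i})
      (fun j => Fintype.card {c // colBlock w c = j}) (blockIndicator w) z := by
  have hIcc : ∀ (f : ℕ → ℕ) (i : ℕ), i ≤ numBlocks w →
      ∑ k ∈ Icc 1 i, f k = ∑ k : Icc 1 (numBlocks w), if (k : ℕ) ≤ i then f k else 0 := by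
    intro f i hi
    rw [Finset.sum_coe_sort (Icc 1 (numBlocks w)) (fun k => if k ≤ i then f k else 0),
      ← Finset.sum_filter]
    refine Finset.sum_congr ?_ fun _ _ => rfl
    ext k
    simp only [Finset.mem_Icc, mem_filter]
    omega
  have hIcc' : ∀ (f : ℕ → ℕ) (m : ℕ), 1 ≤ m →
      ∑ i ∈ Icc m (numBlocks w), f i =
        ∑ i : Icc 1 (numBlocks w), if m ≤ (i : ℕ) then f i else 0 := by
    intro f m hm
    rw [Finset.sum_coe_sort (Icc 1 (numBlocks w)) (fun i => if m ≤ i then f i else 0),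
      ← Finset.sum_filter]
    refine Finset.sum_congr ?_ fun _ _ => rfl
    ext k
    simp only [Finset.mem_Icc, mem_filter]
    omega
  simp_rw [card_rowBlock_fiber, card_colBlock_fiber]
  constructor
  · rintro ⟨z, hz⟩
    refine ⟨fun i j k => if (j : ℕ) ≤ i ∧ (k : ℕ) ≤ i then z i j k else 0, fun i j => ?_,
      fun i k => ?_, fun j k => ?_⟩
    · have hi := Finset.mem_Icc.1 i.2
      by_cases h : j ≤ i
      · have := hz.sum_symbols i j (Finset.mem_Icc.1 j.2).1 h hi.2
        rw [hIcc _ _ hi.2] at this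
        simpa [h, blockIndicator] using this
      · simp [h, blockIndicator]
    · have hi := Finset.mem_Icc.1 i.2
      by_cases h : k ≤ i
      · have := hz.sum_columns i k (Finset.mem_Icc.1 k.2).1 h hi.2
        rw [hIcc _ _ hi.2] at this
        simpa [h, blockIndicator] using this
      · simp [h, blockIndicator]
    · have hj := Finset.mem_Icc.1 j.2
      have hk := Finset.mem_Icc.1 k.2
      have := hz.sum_rows j k hj.1 hj.2 hk.1 hk.2
      rw [hIcc' _ _ (by omega)] at this
      simpa using this
  · rintro ⟨z, hz⟩
    have hzero : ∀ i j k, ¬ (j ≤ i ∧ k ≤ i) → z i j k = 0 := by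
      intro i j k h
      rcases not_and_or.1 h with h | h
      · have := hz.sum_symbols i j
        simp only [blockIndicator, if_neg h, mul_zero] at this
        exact Finset.sum_eq_zero_iff.1 this k (mem_univ k)
      · have := hz.sum_columns i k
        simp only [blockIndicator, if_neg h, mul_zero] at this
        exact Finset.sum_eq_zero_iff.1 this j (mem_univ j)
    let Z : ℕ → ℕ → ℕ → ℕ := fun i j k =>
      if h : i ∈ Icc 1 (numBlocks w) ∧ j ∈ Icc 1 (numBlocks w) ∧ k ∈ Icc 1 (numBlocks w) then
        z ⟨i, h.1⟩ ⟨j, h.2.1⟩ ⟨k, h.2.2⟩ else 0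
    have hZ : ∀ i j k : Icc 1 (numBlocks w), Z i j k = z i j k := by
      intro i j k
      exact dif_pos ⟨i.2, j.2, k.2⟩
    refine ⟨Z, fun i j hj hji hi => ?_, fun i k hk hki hi => ?_, fun j k hj hj' hk hk' => ?_⟩
    · lift i to Icc 1 (numBlocks w) using Finset.mem_Icc.2 ⟨by omega, hi⟩
      lift j to Icc 1 (numBlocks w) using Finset.mem_Icc.2 ⟨hj, by omega⟩
      have h := hz.sum_symbols i j
      rw [blockIndicator, if_pos (show j ≤ i from hji), mul_one] at h
      rw [hIcc _ _ hi, ← h]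
      refine Finset.sum_congr rfl fun k _ => ?_
      rw [hZ]
      split_ifs with hki
      · rfl
      · exact (hzero i j k fun h => hki h.2).symm
    · lift i to Icc 1 (numBlocks w) using Finset.mem_Icc.2 ⟨by omega, hi⟩
      lift k to Icc 1 (numBlocks w) using Finset.mem_Icc.2 ⟨hk, by omega⟩
      have h := hz.sum_columns i k
      rw [blockIndicator, if_pos (show k ≤ i from hki), mul_one] at h
      rw [hIcc _ _ hi, ← h]
      refine Finset.sum_congr rfl fun j _ => ?_
      rw [hZ]
      split_ifs with hji
      · rfl
      · exact (hzero i j k fun h => hji h.1).symm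
    · lift j to Icc 1 (numBlocks w) using Finset.mem_Icc.2 ⟨hj, hj'⟩
      lift k to Icc 1 (numBlocks w) using Finset.mem_Icc.2 ⟨hk, hk'⟩
      rw [hIcc' _ _ (by omega)]
      refine le_trans (Finset.sum_le_sum fun i _ => ?_) (hz.sum_rows j k)
      rw [hZ]
      split_ifs
      · rfl
      · exact Nat.zero_le _

end Blocks

/-! ### Incidence arrays and Latin fillings -/

theorem exists_eq_one_of_sum_eq_one {T : Type*} [Fintype T] {g : T → ℕ} (h : ∑ t, g t = 1) :
    ∃ t, g t = 1 := by
  by_contra! hne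
  have hle : ∀ t, g t ≤ 1 := fun t =>
    (Finset.single_le_sum (fun _ _ => Nat.zero_le _) (mem_univ t)).trans_eq h
  have : ∑ t, g t = 0 := Finset.sum_eq_zero fun t _ => by
    have := hle t
    have := hne t
    omega
  omega

theorem eq_of_sum_le_one {T : Type*} [Fintype T] {g : T → ℕ} (h : ∑ t, g t ≤ 1) {s t : T}
    (hs : g s = 1) (ht : g t = 1) : s = t := by
  classical
  by_contra hne
  have h1 : ∑ x ∈ {s, t}, g x ≤ ∑ x, g x := Finset.sum_le_sum_of_subset (subset_univ _)
  rw [Finset.sum_pair hne] at h1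
  omega

section Diagram

variable (w : List ℕ)

theorem blockIndicator_rowBlock_colBlock (r : Fin w.length) (c : Fin (blockLen w (numBlocks w))) :
    blockIndicator w (rowBlock w r) (colBlock w c) = if (c : ℕ) < w[r] then 1 else 0 := by
  simp_rw [blockIndicator, lt_getElem_iff]

theorem mem_ofRowLens_iff (hw : w.SortedGE) (r : Fin w.length) (c : ℕ) :
    ((r : ℕ), c) ∈ YoungDiagram.ofRowLens w hw ↔ c < w[r] := by
  simp [YoungDiagram.mem_ofRowLens]

theorem isLatin_iff_exists_isIncidenceArray (hw : w.SortedGE) :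
    IsLatin (YoungDiagram.ofRowLens w hw) ↔
      ∃ x, IsIncidenceArray (fun r c => blockIndicator w (rowBlock w r) (colBlock w c)) x := by
  classical
  simp_rw [blockIndicator_rowBlock_colBlock]
  constructor
  · rintro ⟨f, hrow, hcol⟩
    have hrow' : ∀ r : Fin w.length, Set.BijOn (f r) {c | c < w[r]} (Set.Icc 1 w[r]) := by
      intro r
      have := hrow r
      simp_rw [mem_ofRowLens_iff, YoungDiagram.rowLen_ofRowLens] at this
      exact this
    -- Symbols are indexed from 0 here, so index `s` stands for the number `s + 1`.
    refine ⟨fun r c s => if (c : ℕ) < w[r] ∧ f r c = s + 1 then 1 else 0, fun r c => ?_,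
      fun r s => ?_, fun c s => ?_⟩
    · split_ifs with hc
      · have hm := (hrow' r).mapsTo hc
        have hle := getElem_le_blockLen w r
        rw [Set.mem_Icc] at hm
        rw [Finset.sum_eq_single ⟨f r c - 1, by omega⟩]
        · rw [if_pos ⟨hc, by simp; omega⟩]
        · intro s _ hs
          rw [if_neg]
          rintro ⟨-, h⟩
          exact hs (Fin.ext (by simp; omega))
        · simp
      · exact Finset.sum_eq_zero fun s _ => if_neg fun h => hc h.1
    · split_ifs with hs
      · obtain ⟨c, hc, hcs⟩ := (hrow' r).surjOn
          (show (s : ℕ) + 1 ∈ Set.Icc 1 w[r] from ⟨by omega, hs⟩)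
        have hle := getElem_le_blockLen w r
        have hc' : c < w[r] := hc
        rw [Finset.sum_eq_single ⟨c, by omega⟩]
        · rw [if_pos ⟨hc, hcs⟩]
        · intro c' _ hne
          rw [if_neg]
          rintro ⟨h1, h2⟩
          exact hne (Fin.ext ((hrow' r).injOn h1 hc (h2.trans hcs.symm)))
        · simp
      · refine Finset.sum_eq_zero fun c _ => if_neg ?_
        rintro ⟨h1, h2⟩
        have hm := (hrow' r).mapsTo h1
        rw [Set.mem_Icc] at hm
        omega
    · rw [Finset.sum_boole, Nat.cast_id, Finset.card_le_one]
      intro r hr r' hr'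
      simp only [mem_filter, mem_univ, true_and] at hr hr'
      exact Fin.ext (hcol c ((mem_ofRowLens_iff w hw r c).2 hr.1)
        ((mem_ofRowLens_iff w hw r' c).2 hr'.1) (hr.2.trans hr'.2.symm))
  · rintro ⟨x, hx⟩
    have hex : ∀ (r : Fin w.length) (c : ℕ), c < w[r] →
        ∃ (hc : c < blockLen w (numBlocks w)) (s : Fin (blockLen w (numBlocks w))),
          x r ⟨c, hc⟩ s = 1 := by
      intro r c hc
      have hc' := hc.trans_le (getElem_le_blockLen w r)
      refine ⟨hc', exists_eq_one_of_sum_eq_one ?_⟩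
      rw [hx.sum_symbols]
      exact if_pos hc
    choose hlt S hS using hex
    -- A symbol index not below the row length has zero sum over the row, so it cannot be chosen.
    have hSlt : ∀ r c hc, (S r c hc : ℕ) < w[r] := by
      intro r c hc
      by_contra h
      have h1 := hx.sum_columns r (S r c hc)
      rw [if_neg h] at h1
      have h2 := Finset.sum_eq_zero_iff.1 h1 ⟨c, hlt r c hc⟩ (mem_univ _)
      have h3 := hS r c hc
      omega
    let f : ℕ → ℕ → ℕ := fun r c =>
      if h : ∃ hr : r < w.length, c < w[r] then S ⟨r, h.1⟩ c h.2 + 1 else 0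
    have hf : ∀ (r : Fin w.length) c (hc : c < w[r]), f r c = S r c hc + 1 := by
      intro r c hc
      exact dif_pos ⟨r.2, hc⟩
    refine ⟨f, fun r => ?_, fun c => ?_⟩
    · by_cases hr : r < w.length
      · lift r to Fin w.length using hr
        simp_rw [mem_ofRowLens_iff, YoungDiagram.rowLen_ofRowLens]
        refine ⟨fun c hc => ?_, fun c hc c' hc' h => ?_, fun s hs => ?_⟩
        · rw [hf r c hc, Set.mem_Icc]
          have := hSlt r c hc
          omega
        · simp only [Set.mem_ofPred_eq] at hc hc'
          rw [hf r c hc, hf r c' hc'] at h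
          have hSS : S r c hc = S r c' hc' := Fin.ext (by omega)
          have h1 := hS r c hc
          rw [hSS] at h1
          have h2 : ∑ c, x r c (S r c' hc') ≤ 1 := by
            rw [hx.sum_columns]
            split_ifs <;> omega
          exact congrArg Fin.val (eq_of_sum_le_one h2 h1 (hS r c' hc'))
        · rw [Set.mem_Icc] at hs
          have hle := getElem_le_blockLen w r
          have h1 := hx.sum_columns r ⟨s - 1, by omega⟩
          rw [if_pos (show s - 1 < w[r] by omega)] at h1
          obtain ⟨c, hcs⟩ := exists_eq_one_of_sum_eq_one h1
          have h2 := hx.sum_symbols r c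
          have hc : (c : ℕ) < w[r] := by
            by_contra h
            rw [if_neg h] at h2
            have := Finset.sum_eq_zero_iff.1 h2 _ (mem_univ ⟨s - 1, by omega⟩)
            omega
          rw [if_pos hc] at h2
          refine ⟨c, hc, ?_⟩
          rw [hf r c hc, eq_of_sum_le_one h2.le (hS r c hc) hcs]
          simp; omega
      -- Rows beyond the list are empty, and so is the interval of numbers required in them.
      · have h0 : ∀ c, (r, c) ∉ YoungDiagram.ofRowLens w hw := by
          intro c hc
          exact hr (YoungDiagram.mem_ofRowLens.1 hc).1
        have h1 : (YoungDiagram.ofRowLens w hw).rowLen r = 0 := by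
          by_contra h
          exact h0 0 (YoungDiagram.mem_iff_lt_rowLen.2 (Nat.pos_of_ne_zero h))
        simp [h0, h1]
    · intro r hr r' hr' h
      obtain ⟨hrl, hc⟩ := YoungDiagram.mem_ofRowLens.1 hr
      obtain ⟨hrl', hc'⟩ := YoungDiagram.mem_ofRowLens.1 hr'
      have h1 := hf ⟨r, hrl⟩ c hc
      have h2 := hf ⟨r', hrl'⟩ c hc'
      have hSS : S ⟨r, hrl⟩ c hc = S ⟨r', hrl'⟩ c hc' := by
        refine Fin.ext ?_
        simp only at h h1 h2
        omega
      have h3 := hS ⟨r, hrl⟩ c hc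
      rw [hSS] at h3
      exact congrArg Fin.val (eq_of_sum_le_one (hx.sum_rows ⟨c, hlt ⟨r, hrl⟩ c hc⟩ _) h3
        (hS ⟨r', hrl'⟩ c hc'))

end Diagram

theorem mainTheorem2 (w : List ℕ) (hw : w.SortedGE) :
    HasAllocation w ↔ IsLatin (YoungDiagram.ofRowLens w hw) := by
  rw [hasAllocation_iff_exists_isOutline, isLatin_iff_exists_isIncidenceArray]
  exact ⟨fun ⟨_, hz⟩ => hz.exists_isIncidenceArray, fun ⟨_, hx⟩ => hx.exists_isOutline⟩
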